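/- **Setting.** A $1$-log-smooth distribution on $\mathbb R$ is a probability measure $\pi\propto\exp(-V)$ with $V:\mathbb R\to\mathbb R$ twice continuously differentiable and $|V'(x)-V'(y)|\le |x-y|$ for all $x,y\in\mathbb R$. For probability measures $\mu,\pi$ on $\mathbb R$, the relative Fisher information is $\mathrm{FI}(\mu\,\|\,\pi)=\mathbb E_\mu\bigl[\,|(\ln\tfrac{d\mu}{d\pi})'|^2\,\bigr]$ if $\mu$ has a locally absolutely continuous density $d\mu/d\pi$ with respect to $\pi$, and $\mathrm{FI}(\mu\,\|\,\pi)=\infty$ otherwise. In the *stronger oracle model* with parameter $M_0$, a randomized adaptive algorithm gets access to a target $\pi\propto\exp(-V)$ through two oracles. The initialization oracle gives it (for free) a probability measure $\mu_0$, together with independent samples from $\mu_0$, where $\mu_0$ has a positive density and $$\max\Bigl\{\sup\ln\frac{\mu_0}{\pi},\ \sup\ln\frac{\pi}{\mu_0}\Bigr\}\le M_0 .$$ The local oracle answers a query $x\in\mathbb R$ by $(V(x),V'(x))$, where $V$ is any potential of $\pi$ (so it is known only up to an additive constant). The complexity of the algorithm is its number of queries to the local oracle; its internal computation is not restricted, and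 it may know $M_0$ and $\varepsilon$. **Corollary.** There is a universal constant $c'>0$ with the following property. For all $C>0$, $k\in\mathbb N$ and $\varepsilon_0\in(0,1)$ there are $a>0$ and $m\in\mathbb N$, depending only on $C$, $k$ and $\varepsilon_0$, such that the following holds. Let $f:[1,\infty)\to\mathbb R_+$ be increasing (not necessarily strictly). Suppose that there is an algorithm in the stronger oracle model which, for all $M_0\ge 1$ and all $\varepsilon\in(0,\varepsilon_0)$, for every $1$-log-smooth distribution $\pi$ on $\mathbb R$ and every valid initialization $\mu_0$ for $\pi$ with parameter $M_0$, almost surely makes at most $N=N(M_0,\varepsilon)$ queries to the local oracle and outputs a sample from a measure $\mu$ with $\sqrt{\mathrm{FI}(\mu\,\|\,\pi)}\le\varepsilon$, where $$N(M_0,\varepsilon)\le f(M_0)\cdot C\,\bigl(\log(1/\varepsilon)\bigr)^k .$$ Then $$f(M_0)\ \ge\ a\,\frac{\exp(c'M_0)}{M_0^{\,m}}\qquad\text{for all } M_0\ge 1;$$ that is, $f(M_0)\ge\widetilde\Omega(\exp(c'M_0))$. -/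

import Mathlib

open MeasureTheory
open scoped ENNReal

noncomputable section

namespace FisherSampling

universe u

/-! ### Log-smooth targets on the line -/

/-- `V` is the potential of a `β`-log-smooth distribution on `ℝ`: it is twice continuously
differentiable, its gradient is `β`-Lipschitz, and `exp (-V)` can be normalized. -/
structure IsLogSmoothPotential (β : ℝ) (V : ℝ → ℝ) : Prop where
  contDiff : ContDiff ℝ 2 V
  lipschitz_grad : ∀ x y : ℝ, |deriv V x - deriv V y| ≤ β * |x - y|
  integrable_exp_neg : Integrable (fun x => Real.exp (-V x)) volume

/-- The probability density `exp (-V) / ∫ exp (-V)`. Potentials that differ by an additive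
constant have the same density. -/
def targetDensity (V : ℝ → ℝ) (x : ℝ) : ℝ :=
  Real.exp (-V x) / ∫ y, Real.exp (-V y)

/-- The target distribution `π ∝ exp (-V)`. -/
def target (V : ℝ → ℝ) : Measure ℝ :=
  volume.withDensity (fun x => ENNReal.ofReal (targetDensity V x))

/-! ### Relative Fisher information -/

/-- `ρ` is a nonnegative, locally absolutely continuous density of `μ` with respect to `π`. -/
structure IsACDensity (μ π : Measure ℝ) (ρ : ℝ → ℝ) : Prop where
  nonneg : ∀ x, 0 ≤ ρ x
  ac : ∀ a b : ℝ, AbsolutelyContinuousOnInterval ρ a b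
  eq_withDensity : μ = π.withDensity (fun x => ENNReal.ofReal (ρ x))

/-- The relative Fisher information `E_μ |(ln (dμ/dπ))'|²`, equal to `∞` if `μ` has no locally
absolutely continuous density with respect to `π`. If `π` has a positive Lebesgue density, then
a locally absolutely continuous density of `μ` is unique, so that the infimum runs over at most
one value. Points where the density vanishes are `μ`-null, and points where it is not
differentiable are Lebesgue-null. -/
def fisherInfo (μ π : Measure ℝ) : ℝ≥0∞ :=
  ⨅ (ρ : ℝ → ℝ) (_ : IsACDensity μ π ρ),
    ∫⁻ x, ENNReal.ofReal ((deriv (fun y => Real.log (ρ y)) x) ^ 2) ∂μ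

/-! ### The stronger oracle model -/

/-- `μ₀` is a valid answer of the stronger initialization oracle for the target `π ∝ exp (-V)`:
a probability measure with a density whose log-ratio to the density of `π` is bounded by `M₀` in
both directions. -/
def IsWarmStart (V : ℝ → ℝ) (M₀ : ℝ) (μ₀ : Measure ℝ) : Prop :=
  IsProbabilityMeasure μ₀ ∧
    ∃ p : ℝ → ℝ, Measurable p ∧ (∀ x, 0 < p x) ∧
      μ₀ = volume.withDensity (fun x => ENNReal.ofReal (p x)) ∧
      ∀ x, Real.log (p x / targetDensity V x) ≤ M₀ ∧
        Real.log (targetDensity V x / p x) ≤ M₀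

/-- What an algorithm does next: query the local oracle at a point, or stop and output a
point. -/
inductive Action : Type
  | query (x : ℝ)
  | output (x : ℝ)

/-- A randomized adaptive sampling algorithm. Its next action may depend on the initial
distribution `μ₀`, on a random seed, on samples `y 0, y 1, …` from `μ₀`, and on the list of the
previous queries `x` with their answers `(V x, V' x)`. It has no other access to the target.
Nothing bounds the cost of the internal computations, and no regularity of `next` is needed; only
the output has to be a random variable, see `OutputsWithin`. -/
structure SamplingAlgorithm where
  Seed : Type u
  [measurableSpaceSeed : MeasurableSpace Seed]
  seedLaw : Measure Seed
  [isProbabilityMeasure_seedLaw : IsProbabilityMeasure seedLaw]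
  next : Measure ℝ → Seed → (ℕ → ℝ) → List (ℝ × ℝ × ℝ) → Action

attribute [instance] SamplingAlgorithm.measurableSpaceSeed
  SamplingAlgorithm.isProbabilityMeasure_seedLaw

/-- Run a strategy against the local oracle `x ↦ (V x, V' x)`, starting from a given history and
with a budget of `N` further queries. The value is the output, or `none` if the strategy asks for
more than `N` queries. -/
def runFrom (V : ℝ → ℝ) (strategy : List (ℝ × ℝ × ℝ) → Action) :
    ℕ → List (ℝ × ℝ × ℝ) → Option ℝ
  | N, history =>
    match strategy history with
    | .output x => some x
    | .query x =>
      match N with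
      | 0 => none
      | n + 1 => runFrom V strategy n (history ++ [(x, V x, deriv V x)])

namespace SamplingAlgorithm

/-- The joint law of the random seed and of independent samples from `μ₀`. -/
def randomness (A : SamplingAlgorithm.{u}) (μ₀ : Measure ℝ) : Measure (A.Seed × (ℕ → ℝ)) :=
  A.seedLaw.prod (Measure.infinitePi (fun _ : ℕ => μ₀))

/-- Given the initial distribution `μ₀` and the local oracle of `V`, the algorithm almost surely
stops after at most `N` queries, and its output is a sample from `μ`. -/
def OutputsWithin (A : SamplingAlgorithm.{u}) (V : ℝ → ℝ) (μ₀ : Measure ℝ) (N : ℕ)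
    (μ : Measure ℝ) : Prop :=
  ∃ X : A.Seed × (ℕ → ℝ) → ℝ, AEMeasurable X (A.randomness μ₀) ∧
    (∀ᵐ ω ∂(A.randomness μ₀), runFrom V (A.next μ₀ ω.1 ω.2) N [] = some (X ω)) ∧
    (A.randomness μ₀).map X = μ

/-- In the stronger oracle model with parameter `M₀`, for every `1`-log-smooth target on `ℝ` and
every valid initialization, the algorithm makes at most `N` queries to the local oracle and outputs
a sample from a measure `μ` whose relative Fisher information satisfies `√FI ≤ ε`. -/
def Solves (A : SamplingAlgorithm.{u}) (M₀ ε : ℝ) (N : ℕ) : Prop :=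
  ∀ V : ℝ → ℝ, IsLogSmoothPotential 1 V → ∀ μ₀ : Measure ℝ, IsWarmStart V M₀ μ₀ →
    ∃ μ : Measure ℝ, A.OutputsWithin V μ₀ N μ ∧
      fisherInfo μ (target V) ^ (1 / 2 : ℝ) ≤ ENNReal.ofReal ε

end SamplingAlgorithm

end FisherSampling

end

open MeasureTheory
open scoped ENNReal

/-! A well of depth `M` is hidden in a Gaussian at one of `n ≈ exp M` places. Its width is
proportional to `M`, which keeps the potential `1`-log-smooth, and the Gaussian has standard
deviation `σ` of order `M * n`, so that all places fit into its bulk. The well then carries a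
constant fraction of the mass. The Gaussian itself is a valid warm start with parameter `M` for
every placement and reveals nothing about it; only a query inside the well does.

Two estimates turn this into a bound. First, small Fisher information forces the output to visit the
well: if `ρ` is the density relative to the target, writing `ρ x - ρ x₀` as an integral of `ρ'` and
exchanging integrals bounds `1 - ρ x₀` by a tail constant `K` times `√FI`
(`one_le_add_mul_rpow_of_isACDensity`). Here `K` is at most a polynomial in `M` times `exp (2 * M)`,
so an accuracy with `log (1 / ε) = O(M)` suffices, which costs only a power of `M` in the query
bound. Second, for fixed randomness `N` queries meet at most `N` of the disjoint wells, and on all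
others the output is the same point (`SamplingAlgorithm.OutputsWithin.sum_measure_le`). Together, `n
/ 32 ≤ N + 1` (`SamplingAlgorithm.Solves.card_wells_le`).

For bounded `M` this may be vacuous. There monotonicity of `f` and a positive lower bound on `f 1`
suffice, the latter because some fixed accuracy cannot be reached without queries
(`exists_forall_not_solves_zero`). -/

namespace FisherSampling

/-! ### Query counting against a reference potential -/

/-- A run against `V₀` makes at most `N` queries, and every potential with the same answers at
these queries leads to the same run. -/
lemma exists_finset_runFrom_eq (V₀ : ℝ → ℝ) (strategy : List (ℝ × ℝ × ℝ) → Action) (N : ℕ) :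
    ∀ history : List (ℝ × ℝ × ℝ), ∃ Q : Finset ℝ, Q.card ≤ N ∧
      ∀ V : ℝ → ℝ, (∀ x ∈ Q, V x = V₀ x ∧ deriv V x = deriv V₀ x) →
        runFrom V strategy N history = runFrom V₀ strategy N history := by
  classical
  induction N with
  | zero =>
    intro history
    refine ⟨∅, le_rfl, fun V _ => ?_⟩
    unfold runFrom
    cases strategy history <;> rfl
  | succ n ih =>
    intro history
    cases hs : strategy history with
    | output x =>
      refine ⟨∅, by simp, fun V _ => ?_⟩
      unfold runFrom
      simp [hs]
    | query x =>
      obtain ⟨Q, hQ, hV⟩ := ih (history ++ [(x, V₀ x, deriv V₀ x)])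
      refine ⟨insert x Q, (Finset.card_insert_le _ _).trans (by omega), fun V hVQ => ?_⟩
      obtain ⟨h1, h2⟩ := hVQ x (by simp)
      unfold runFrom
      simp only [hs]
      rw [h1, h2]
      exact hV V fun y hy => hVQ y (by simp [hy])

/-- Each point queried in the run against `V₀` lies in at most one `S i`, so at most `N` indices are
touched; for the others all answers coincide. -/
lemma exists_forall_runFrom_eq_of_pairwise_disjoint {ι : Type*} [Fintype ι] [DecidableEq ι]
    {V₀ : ℝ → ℝ} {V : ι → ℝ → ℝ} {S : ι → Set ℝ} (hS : Pairwise (Function.onFun Disjoint S))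
    (hV : ∀ i, ∀ x ∉ S i, V i x = V₀ x ∧ deriv (V i) x = deriv V₀ x)
    (strategy : List (ℝ × ℝ × ℝ) → Action) (N : ℕ) :
    ∃ J : Finset ι, J.card ≤ N ∧
      ∀ i ∉ J, runFrom (V i) strategy N [] = runFrom V₀ strategy N [] := by
  classical
  obtain ⟨Q, hQ, hrun⟩ := exists_finset_runFrom_eq V₀ strategy N []
  refine ⟨Finset.univ.filter fun i => ∃ x ∈ Q, x ∈ S i, ?_, fun i hi => ?_⟩
  · refine le_trans ?_ hQ
    have hex : ∀ i ∈ Finset.univ.filter fun i => ∃ x ∈ Q, x ∈ S i, ∃ x ∈ Q, x ∈ S i := by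
      intro i hi
      simpa using hi
    choose! g hgQ hgS using hex
    refine Finset.card_le_card_of_injOn g (fun i hi => hgQ i hi) ?_
    intro i hi j hj hij
    by_contra hne
    exact Set.disjoint_left.1 (hS hne) (hgS i hi) (hij ▸ hgS j hj)
  · refine hrun (V i) fun x hx => hV i x fun hxS => hi ?_
    simp only [Finset.mem_filter, Finset.mem_univ, true_and]
    exact ⟨x, hx, hxS⟩

instance (A : SamplingAlgorithm) (μ₀ : Measure ℝ) [IsProbabilityMeasure μ₀] :
    IsProbabilityMeasure (A.randomness μ₀) := by
  unfold SamplingAlgorithm.randomness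
  infer_instance

lemma SamplingAlgorithm.OutputsWithin.isProbabilityMeasure {A : SamplingAlgorithm} {V : ℝ → ℝ}
    {μ₀ μ : Measure ℝ} [IsProbabilityMeasure μ₀] {N : ℕ} (h : A.OutputsWithin V μ₀ N μ) :
    IsProbabilityMeasure μ := by
  obtain ⟨X, hX, -, rfl⟩ := h
  exact Measure.isProbabilityMeasure_map hX

/-- If the potentials `V i` agree with `V₀` outside of disjoint sets, then outputs in disjoint sets
`B i` require many queries. The strategy need not be measurable. -/
lemma SamplingAlgorithm.OutputsWithin.sum_measure_le {A : SamplingAlgorithm} {ι : Type*} [Fintype ι]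
    {V₀ : ℝ → ℝ} {V : ι → ℝ → ℝ} {S B : ι → Set ℝ} {μ₀ ν₀ : Measure ℝ} {ν : ι → Measure ℝ}
    [IsProbabilityMeasure μ₀] {N : ℕ}
    (hS : Pairwise (Function.onFun Disjoint S)) (hB : Pairwise (Function.onFun Disjoint B))
    (hBm : ∀ i, MeasurableSet (B i))
    (hV : ∀ i, ∀ x ∉ S i, V i x = V₀ x ∧ deriv (V i) x = deriv V₀ x)
    (h₀ : A.OutputsWithin V₀ μ₀ N ν₀) (h : ∀ i, A.OutputsWithin (V i) μ₀ N (ν i)) :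
    ∑ i, ν i (B i) ≤ N + 1 := by
  classical
  obtain ⟨X₀, -, hrun₀, -⟩ := h₀
  choose X hX hrun hmap using h
  have hν : ∀ i, ν i (B i) = ∫⁻ ω, (B i).indicator 1 (X i ω) ∂(A.randomness μ₀) := by
    intro i
    rw [← lintegral_map' ((measurable_one.indicator (hBm i)).aemeasurable) (hX i), hmap i,
      lintegral_indicator_one (hBm i)]
  simp only [hν]
  rw [← lintegral_finsetSum' (f := fun i ω => (B i).indicator (1 : ℝ → ℝ≥0∞) (X i ω)) _
    fun i _ => (measurable_one.indicator (hBm i)).comp_aemeasurable (hX i)]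
  -- With the randomness fixed, the outputs for `i ∉ J` all equal `X₀ ω`, which lies in at most one
  -- `B i`. The set `J` may depend on `ω` non-measurably; only the bound on its cardinality is
  -- integrated.
  have hpt : ∀ᵐ ω ∂(A.randomness μ₀),
      ∑ i, (B i).indicator (1 : ℝ → ℝ≥0∞) (X i ω) ≤ (N : ℝ≥0∞) + 1 := by
    filter_upwards [hrun₀, ae_all_iff.2 hrun] with ω h0 hi
    obtain ⟨J, hJ, hJrun⟩ :=
      exists_forall_runFrom_eq_of_pairwise_disjoint hS hV (A.next μ₀ ω.1 ω.2) N
    have heq : ∀ i ∉ J, X i ω = X₀ ω := by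
      intro i hiJ
      have := hJrun i hiJ
      rw [h0, hi i] at this
      exact Option.some.inj this
    have hsum : ∑ i, (B i).indicator (1 : ℝ → ℝ≥0∞) (X i ω)
        = (((Finset.univ.filter fun i => X i ω ∈ B i).card : ℕ) : ℝ≥0∞) := by
      rw [Finset.card_filter]
      push_cast
      refine Finset.sum_congr rfl fun i _ => ?_
      by_cases hxi : X i ω ∈ B i <;> simp [hxi]
    rw [hsum]
    have hsub : (Finset.univ.filter fun i => X i ω ∈ B i) ⊆
        J ∪ Finset.univ.filter fun i => X₀ ω ∈ B i := by
      intro i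
      simp only [Finset.mem_filter, Finset.mem_univ, true_and, Finset.mem_union]
      intro hxi
      by_cases hiJ : i ∈ J
      · exact Or.inl hiJ
      · exact Or.inr (heq i hiJ ▸ hxi)
    have hone : (Finset.univ.filter fun i => X₀ ω ∈ B i).card ≤ 1 := by
      refine Finset.card_le_one.2 fun i hi j hj => ?_
      simp only [Finset.mem_filter, Finset.mem_univ, true_and] at hi hj
      by_contra hne
      exact Set.disjoint_left.1 (hB hne) hi hj
    have := (Finset.card_le_card hsub).trans ((Finset.card_union_le _ _).trans
      (add_le_add hJ hone))
    exact_mod_cast this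
  calc ∫⁻ ω, ∑ i, (B i).indicator (1 : ℝ → ℝ≥0∞) (X i ω) ∂(A.randomness μ₀)
      ≤ ∫⁻ _, ((N : ℝ≥0∞) + 1) ∂(A.randomness μ₀) := lintegral_mono_ae hpt
    _ = N + 1 := by simp

/-! ### Fisher information controls the density from below -/

/-- A zero of `ρ` is a minimum, so `deriv ρ` vanishes there; at points of non-differentiability it
is `0` by convention. Elsewhere this is the logarithmic derivative. -/
lemma abs_deriv_le_abs_deriv_log_mul {ρ : ℝ → ℝ} (hρ : ∀ x, 0 ≤ ρ x) (t : ℝ) :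
    |deriv ρ t| ≤ |deriv (fun y => Real.log (ρ y)) t| * ρ t := by
  rcases (hρ t).eq_or_lt with h0 | hpos
  · have hmin : IsLocalMin ρ t := Filter.Eventually.of_forall fun x => h0 ▸ hρ x
    rw [hmin.deriv_eq_zero, ← h0]
    simp
  · by_cases hd : DifferentiableAt ℝ ρ t
    · rw [deriv.log hd hpos.ne', abs_div, abs_of_pos hpos, div_mul_cancel₀ _ hpos.ne']
    · rw [deriv_zero_of_not_differentiableAt hd, abs_zero]
      positivity

lemma ofReal_le_add_lintegral_deriv {ρ : ℝ → ℝ}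
    (hρ : ∀ a b, AbsolutelyContinuousOnInterval ρ a b) (x₀ x : ℝ) :
    ENNReal.ofReal (ρ x) ≤
      ENNReal.ofReal (ρ x₀) + ∫⁻ t in Set.uIoc x₀ x, ENNReal.ofReal |deriv ρ t| := by
  have hint := (hρ x₀ x).intervalIntegrable_deriv
  have hI : Integrable (fun t => |deriv ρ t|) (volume.restrict (Set.uIoc x₀ x)) := by
    have := intervalIntegrable_iff.1 hint
    exact this.norm
  rw [← ofReal_integral_eq_lintegral_ofReal hI (Filter.Eventually.of_forall fun _ => abs_nonneg _)]
  refine le_trans (ENNReal.ofReal_le_ofReal ?_) ENNReal.ofReal_add_le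
  have h1 := (hρ x₀ x).integral_deriv_eq_sub
  have h2 := intervalIntegral.norm_integral_le_integral_norm_uIoc
    (f := deriv ρ) (a := x₀) (b := x) (μ := volume)
  rw [h1] at h2
  simp only [Real.norm_eq_abs] at h2
  linarith [le_abs_self (ρ x - ρ x₀)]

/-- Cauchy–Schwarz against the constant `1`. -/
lemma lintegral_ofReal_abs_le_rpow {μ : Measure ℝ} [IsProbabilityMeasure μ] {g : ℝ → ℝ}
    (hg : Measurable g) :
    ∫⁻ x, ENNReal.ofReal |g x| ∂μ ≤ (∫⁻ x, ENNReal.ofReal (g x ^ 2) ∂μ) ^ (1 / 2 : ℝ) := by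
  have h := ENNReal.lintegral_mul_le_Lp_mul_Lq μ (p := 2) (q := 2) (by
    rw [Real.holderConjugate_iff]; norm_num) (f := fun x => ENNReal.ofReal |g x|) (g := fun _ => 1)
    (by fun_prop) (by fun_prop)
  simp only [Pi.mul_apply, mul_one, ENNReal.one_rpow, lintegral_one, measure_univ] at h
  refine h.trans (le_of_eq ?_)
  congr 2
  ext x
  rw [show (2 : ℝ) = ((2 : ℕ) : ℝ) by norm_num, ENNReal.rpow_natCast,
    ← ENNReal.ofReal_pow (abs_nonneg _), sq_abs]

/-- If the tails of `p` seen from `x₀` are at most `K` times `p`, then a density with small Fisher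
information cannot be much smaller than `1` at `x₀`. -/
lemma one_le_add_mul_rpow_of_isACDensity {p : ℝ → ℝ} (hp : Continuous p)
    {π μ : Measure ℝ} (hπ : π = volume.withDensity fun x => ENNReal.ofReal (p x))
    [IsProbabilityMeasure π] [IsProbabilityMeasure μ] {ρ : ℝ → ℝ} (hρ : IsACDensity μ π ρ)
    {K : ℝ≥0∞} {x₀ : ℝ}
    (hR : ∀ t, x₀ ≤ t → ∫⁻ x in Set.Ici t, ENNReal.ofReal (p x) ≤ K * ENNReal.ofReal (p t))
    (hL : ∀ t, t ≤ x₀ → ∫⁻ x in Set.Iic t, ENNReal.ofReal (p x) ≤ K * ENNReal.ofReal (p t)) :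
    1 ≤ ENNReal.ofReal (ρ x₀) + K *
      (∫⁻ x, ENNReal.ofReal ((deriv (fun y => Real.log (ρ y)) x) ^ 2) ∂μ) ^ (1 / 2 : ℝ) := by
  have hρc : Continuous ρ := by
    refine continuous_iff_continuousAt.2 fun x => ?_
    have := (hρ.ac (x - 1) (x + 1)).continuousOn
    refine this.continuousAt ?_
    rw [Set.uIcc_of_le (by linarith)]
    exact Icc_mem_nhds (by linarith) (by linarith)
  have hρm : Measurable ρ := hρc.measurable
  have hpm : Measurable p := hp.measurable
  have hdm : Measurable (deriv ρ) := measurable_deriv ρ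
  have hlm : Measurable (deriv fun y => Real.log (ρ y)) := measurable_deriv _
  have hμlint : ∀ g : ℝ → ℝ≥0∞, Measurable g →
      ∫⁻ x, g x ∂μ = ∫⁻ x, ENNReal.ofReal (p x) * (ENNReal.ofReal (ρ x) * g x) := by
    intro g hg
    rw [hρ.eq_withDensity, lintegral_withDensity_eq_lintegral_mul _ (by fun_prop) hg, hπ,
      lintegral_withDensity_eq_lintegral_mul _ (by fun_prop) (by fun_prop)]
    rfl
  have hmass : ∫⁻ x, ENNReal.ofReal (p x) = 1 := by
    have : π Set.univ = 1 := measure_univ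
    rwa [hπ, withDensity_apply _ MeasurableSet.univ, Measure.restrict_univ] at this
  have hE : MeasurableSet {z : ℝ × ℝ | z.2 ∈ Set.uIoc x₀ z.1} := by
    have : {z : ℝ × ℝ | z.2 ∈ Set.uIoc x₀ z.1} =
        {z | min x₀ z.1 < z.2} ∩ {z | z.2 ≤ max x₀ z.1} := by
      ext z
      simp [Set.uIoc]
    rw [this]
    exact (measurableSet_lt (by fun_prop) (by fun_prop)).inter
      (measurableSet_le (by fun_prop) (by fun_prop))
  let F : ℝ → ℝ → ℝ≥0∞ := fun x t => {z : ℝ × ℝ | z.2 ∈ Set.uIoc x₀ z.1}.indicator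
    (fun z => ENNReal.ofReal (p z.1) * ENNReal.ofReal |deriv ρ z.2|) (x, t)
  have hF : Measurable (Function.uncurry F) :=
    Measurable.indicator (f := fun z : ℝ × ℝ =>
      ENNReal.ofReal (p z.1) * ENNReal.ofReal |deriv ρ z.2|) (by fun_prop) hE
  have hrow : ∀ x, ENNReal.ofReal (p x) * ∫⁻ t in Set.uIoc x₀ x, ENNReal.ofReal |deriv ρ t|
      = ∫⁻ t, F x t := by
    intro x
    rw [← lintegral_indicator measurableSet_uIoc, ← lintegral_const_mul _
      (Measurable.indicator (by fun_prop) measurableSet_uIoc)]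
    refine lintegral_congr fun t => ?_
    by_cases ht : t ∈ Set.uIoc x₀ x <;> simp [F, ht]
  -- The points `x` separated from `x₀` by `t` lie in the tail beyond `t`, so one of the two tail
  -- bounds applies.
  have hcol : ∀ t, ∫⁻ x, F x t ≤ K * (ENNReal.ofReal (p t) * ENNReal.ofReal |deriv ρ t|) := by
    intro t
    rw [← mul_assoc]
    rcases lt_or_ge x₀ t with h | h
    · calc ∫⁻ x, F x t
          ≤ ∫⁻ x, (Set.Ici t).indicator (fun x => ENNReal.ofReal (p x)) x *
              ENNReal.ofReal |deriv ρ t| := by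
            refine lintegral_mono fun x => ?_
            simp only [F, Set.indicator, Set.mem_ofPred_eq, Set.mem_uIoc, Set.mem_Ici]
            split_ifs with h1 h2
            · exact le_rfl
            · exfalso
              rcases h1 with h1 | h1 <;> linarith
            · exact zero_le
            · exact zero_le
        _ ≤ _ := by
            rw [lintegral_mul_const _ (Measurable.indicator (by fun_prop) measurableSet_Ici),
              lintegral_indicator measurableSet_Ici]
            gcongr
            exact hR t h.le
    · calc ∫⁻ x, F x t
          ≤ ∫⁻ x, (Set.Iic t).indicator (fun x => ENNReal.ofReal (p x)) x *
              ENNReal.ofReal |deriv ρ t| := by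
            refine lintegral_mono fun x => ?_
            simp only [F, Set.indicator, Set.mem_ofPred_eq, Set.mem_uIoc, Set.mem_Iic]
            split_ifs with h1 h2
            · exact le_rfl
            · exfalso
              rcases h1 with h1 | h1 <;> linarith
            · exact zero_le
            · exact zero_le
        _ ≤ _ := by
            rw [lintegral_mul_const _ (Measurable.indicator (by fun_prop) measurableSet_Iic),
              lintegral_indicator measurableSet_Iic]
            gcongr
            exact hL t h
  calc (1 : ℝ≥0∞) = ∫⁻ _, 1 ∂μ := by simp
    _ = ∫⁻ x, ENNReal.ofReal (p x) * ENNReal.ofReal (ρ x) := by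
        rw [hμlint _ measurable_const]
        simp
    _ ≤ ∫⁻ x, (ENNReal.ofReal (p x) * ENNReal.ofReal (ρ x₀) + ∫⁻ t, F x t) := by
        refine lintegral_mono fun x => ?_
        rw [← hrow, ← mul_add]
        gcongr
        exact ofReal_le_add_lintegral_deriv hρ.ac x₀ x
    _ = ENNReal.ofReal (ρ x₀) + ∫⁻ t, ∫⁻ x, F x t := by
        rw [lintegral_add_left (by fun_prop), lintegral_mul_const _ (by fun_prop), hmass, one_mul,
          lintegral_lintegral_swap hF.aemeasurable]
    _ ≤ ENNReal.ofReal (ρ x₀) +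
        ∫⁻ t, K * (ENNReal.ofReal (p t) * ENNReal.ofReal |deriv ρ t|) := by
        gcongr with t
        exact hcol t
    _ = ENNReal.ofReal (ρ x₀) +
        K * ∫⁻ t, ENNReal.ofReal (p t) * ENNReal.ofReal |deriv ρ t| := by
        rw [lintegral_const_mul _ (by fun_prop)]
    _ ≤ ENNReal.ofReal (ρ x₀) +
        K * ∫⁻ t, ENNReal.ofReal |deriv (fun y => Real.log (ρ y)) t| ∂μ := by
        rw [hμlint _ (by fun_prop)]
        gcongr with t
        rw [mul_comm (ENNReal.ofReal (ρ t)), ← ENNReal.ofReal_mul (abs_nonneg _)]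
        exact ENNReal.ofReal_le_ofReal (abs_deriv_le_abs_deriv_log_mul hρ.nonneg t)
    _ ≤ _ := by
        gcongr
        exact lintegral_ofReal_abs_le_rpow hlm

/-- Small Fisher information keeps almost all of the mass of the target on a set from which the
tails of the target are controlled. -/
lemma ofReal_mul_measure_le_of_fisherInfo_le {p : ℝ → ℝ} (hp : Continuous p)
    {π μ : Measure ℝ} (hπ : π = volume.withDensity fun x => ENNReal.ofReal (p x))
    [IsProbabilityMeasure π] [IsProbabilityMeasure μ] {K ε : ℝ} {B : Set ℝ}
    (hB : MeasurableSet B) (hK : 0 ≤ K) (hε : 0 < ε)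
    (hR : ∀ x₀ ∈ B, ∀ t, x₀ ≤ t →
      ∫⁻ x in Set.Ici t, ENNReal.ofReal (p x) ≤ ENNReal.ofReal K * ENNReal.ofReal (p t))
    (hL : ∀ x₀ ∈ B, ∀ t, t ≤ x₀ →
      ∫⁻ x in Set.Iic t, ENNReal.ofReal (p x) ≤ ENNReal.ofReal K * ENNReal.ofReal (p t))
    (hFI : fisherInfo μ π ^ (1 / 2 : ℝ) ≤ ENNReal.ofReal ε) :
    ENNReal.ofReal (1 - 2 * K * ε) * π B ≤ μ B := by
  -- Doubling `ε` makes the inequality strict, so that some density in the infimum satisfies it.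
  -- This is the `2` in `1 - 2 * K * ε`.
  have hlt : fisherInfo μ π < ENNReal.ofReal (2 * ε) ^ (2 : ℝ) := by
    have h1 : fisherInfo μ π = (fisherInfo μ π ^ (1 / 2 : ℝ)) ^ (2 : ℝ) := by
      rw [← ENNReal.rpow_mul]
      norm_num
    rw [h1]
    refine ENNReal.rpow_lt_rpow (hFI.trans_lt ?_) (by norm_num)
    rw [ENNReal.ofReal_lt_ofReal_iff (by positivity)]
    linarith
  simp only [fisherInfo, iInf_lt_iff] at hlt
  obtain ⟨ρ, hρ, hI⟩ := hlt
  have hI' : (∫⁻ x, ENNReal.ofReal ((deriv (fun y => Real.log (ρ y)) x) ^ 2) ∂μ) ^ (1 / 2 : ℝ)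
      ≤ ENNReal.ofReal (2 * ε) := by
    have := ENNReal.rpow_le_rpow hI.le (show (0 : ℝ) ≤ 1 / 2 by norm_num)
    rwa [← ENNReal.rpow_mul, show (2 : ℝ) * (1 / 2) = 1 by norm_num, ENNReal.rpow_one] at this
  have hpt : ∀ x ∈ B, ENNReal.ofReal (1 - 2 * K * ε) ≤ ENNReal.ofReal (ρ x) := by
    intro x hx
    have h := one_le_add_mul_rpow_of_isACDensity hp hπ hρ (hR x hx) (hL x hx)
    have h2 : (1 : ℝ≥0∞) ≤ ENNReal.ofReal (ρ x + K * (2 * ε)) := by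
      rw [ENNReal.ofReal_add (hρ.nonneg x) (by positivity), ENNReal.ofReal_mul hK]
      refine h.trans ?_
      gcongr
    rw [ENNReal.one_le_ofReal] at h2
    exact ENNReal.ofReal_le_ofReal (by linarith)
  rw [hρ.eq_withDensity, withDensity_apply _ hB, ← setLIntegral_const]
  exact setLIntegral_mono' hB hpt

/-! ### Bounded perturbations of Gaussians -/

/-- `V` is the potential of a centred Gaussian with variance `σ²`, lowered by at most `h`. -/
structure IsLoweredGaussian (σ h : ℝ) (V : ℝ → ℝ) : Prop where
  sigma_pos : 0 < σ
  continuous : Continuous V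
  lower : ∀ x, x ^ 2 / (2 * σ ^ 2) - h ≤ V x
  upper : ∀ x, V x ≤ x ^ 2 / (2 * σ ^ 2)

lemma integrable_exp_neg_sq_div {σ : ℝ} (hσ : 0 < σ) :
    Integrable fun x : ℝ => Real.exp (-(x ^ 2 / (2 * σ ^ 2))) := by
  have h := integrable_exp_neg_mul_sq (b := 1 / (2 * σ ^ 2)) (by positivity)
  refine h.congr (Filter.Eventually.of_forall fun x => ?_)
  simp only
  congr 1
  ring

lemma integral_exp_neg_sq_div_le {σ : ℝ} (hσ : 0 < σ) :
    ∫ x : ℝ, Real.exp (-(x ^ 2 / (2 * σ ^ 2))) ≤ 3 * σ := by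
  have h := integral_gaussian (1 / (2 * σ ^ 2))
  have h2 : ∫ x : ℝ, Real.exp (-(x ^ 2 / (2 * σ ^ 2))) =
      ∫ x : ℝ, Real.exp (-(1 / (2 * σ ^ 2)) * x ^ 2) := by
    congr 1
    ext x
    congr 1
    ring
  rw [h2, h]
  refine Real.sqrt_le_iff.2 ⟨by positivity, ?_⟩
  rw [div_div_eq_mul_div, div_one]
  nlinarith [Real.pi_lt_four, sq_nonneg σ, Real.pi_pos]

lemma targetDensity_comp_neg (V : ℝ → ℝ) (x : ℝ) :
    targetDensity (fun x => V (-x)) x = targetDensity V (-x) := by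
  rw [targetDensity, targetDensity, integral_neg_eq_self fun y => Real.exp (-V y)]

namespace IsLoweredGaussian

variable {σ h : ℝ} {V : ℝ → ℝ}

lemma integrable (hV : IsLoweredGaussian σ h V) : Integrable fun x => Real.exp (-V x) := by
  refine ((integrable_exp_neg_sq_div hV.sigma_pos).const_mul (Real.exp h)).mono'
    (Real.continuous_exp.comp hV.continuous.neg).aestronglyMeasurable
    (Filter.Eventually.of_forall fun x => ?_)
  rw [Real.norm_eq_abs, Real.abs_exp, ← Real.exp_add]
  exact Real.exp_le_exp.2 (by linarith [hV.lower x])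

lemma integral_pos (hV : IsLoweredGaussian σ h V) : 0 < ∫ x, Real.exp (-V x) :=
  integral_exp_pos hV.integrable

lemma targetDensity_pos (hV : IsLoweredGaussian σ h V) (x : ℝ) : 0 < targetDensity V x :=
  div_pos (Real.exp_pos _) hV.integral_pos

lemma continuous_targetDensity (hV : IsLoweredGaussian σ h V) : Continuous (targetDensity V) :=
  (Real.continuous_exp.comp hV.continuous.neg).div_const _

lemma isProbabilityMeasure_target (hV : IsLoweredGaussian σ h V) :
    IsProbabilityMeasure (target V) := by
  refine ⟨?_⟩
  have hint : Integrable (targetDensity V) := hV.integrable.div_const _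
  rw [target, withDensity_apply _ MeasurableSet.univ, Measure.restrict_univ,
    ← ofReal_integral_eq_lintegral_ofReal hint
      (Filter.Eventually.of_forall fun x => (hV.targetDensity_pos x).le)]
  simp only [targetDensity]
  rw [integral_div, div_self hV.integral_pos.ne', ENNReal.ofReal_one]

/-- Lowering the potential raises the normalizing constant by a factor between `1` and `exp h`. The
two effects enter the log-ratio with opposite signs, so it is bounded by `h` rather than `2 * h`. -/
lemma isWarmStart {V₀ : ℝ → ℝ} (hV : IsLoweredGaussian σ h V) (hV₀ : IsLoweredGaussian σ 0 V₀) :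
    IsWarmStart V h (target V₀) := by
  have hV₀eq : ∀ x, V₀ x = x ^ 2 / (2 * σ ^ 2) := fun x =>
    le_antisymm (hV₀.upper x) (by simpa using hV₀.lower x)
  refine ⟨hV₀.isProbabilityMeasure_target, targetDensity V₀,
    hV₀.continuous_targetDensity.measurable, hV₀.targetDensity_pos, rfl, fun x => ?_⟩
  have hZ := hV.integral_pos
  have hZ₀ := hV₀.integral_pos
  have h1 : ∫ y, Real.exp (-V₀ y) ≤ ∫ y, Real.exp (-V y) :=
    integral_mono hV₀.integrable hV.integrable fun y =>
      Real.exp_le_exp.2 (by linarith [hV.upper y, hV₀eq y])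
  have h2 : ∫ y, Real.exp (-V y) ≤ Real.exp h * ∫ y, Real.exp (-V₀ y) := by
    rw [← integral_const_mul]
    refine integral_mono hV.integrable (hV₀.integrable.const_mul _) fun y => ?_
    simp only
    rw [← Real.exp_add]
    exact Real.exp_le_exp.2 (by linarith [hV.lower y, hV₀eq y])
  have l1 := Real.log_le_log hZ₀ h1
  have l2 := Real.log_le_log hZ h2
  rw [Real.log_mul (Real.exp_pos _).ne' hZ₀.ne', Real.log_exp] at l2
  have hlog : ∀ W : ℝ → ℝ, 0 < ∫ y, Real.exp (-W y) →
      Real.log (targetDensity W x) = -W x - Real.log (∫ y, Real.exp (-W y)) := by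
    intro W hW
    rw [targetDensity, Real.log_div (Real.exp_pos _).ne' hW.ne', Real.log_exp]
  rw [Real.log_div (hV₀.targetDensity_pos x).ne' (hV.targetDensity_pos x).ne',
    Real.log_div (hV.targetDensity_pos x).ne' (hV₀.targetDensity_pos x).ne', hlog V hZ,
    hlog V₀ hZ₀]
  constructor <;> linarith [hV.lower x, hV.upper x, hV₀eq x]

/-- In units of `σ`, with `d = (s - t) / σ`, the Gaussian part reduces to `(d - (l + 1)) ^ 2 ≥ 0`;
the lowering costs at most `h`. -/
lemma growth_right (hV : IsLoweredGaussian σ h V) {l s t : ℝ} (ht : -(l * σ) ≤ t)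
    (hst : t ≤ s) :
    (s - t) / σ - ((l + 1) ^ 2 / 2 + h) ≤ V s - V t := by
  have hσ := hV.sigma_pos
  have key : (s - t) / σ - (l + 1) ^ 2 / 2 ≤ s ^ 2 / (2 * σ ^ 2) - t ^ 2 / (2 * σ ^ 2) := by
    obtain ⟨u, rfl⟩ : ∃ u, s = σ * u := ⟨s / σ, by field_simp⟩
    obtain ⟨v, rfl⟩ : ∃ v, t = σ * v := ⟨t / σ, by field_simp⟩
    have hv : -l ≤ v := by nlinarith
    have huv : v ≤ u := le_of_mul_le_mul_left hst hσ
    have e1 : (σ * u - σ * v) / σ = u - v := by field_simp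
    have e2 : ∀ z : ℝ, (σ * z) ^ 2 / (2 * σ ^ 2) = z ^ 2 / 2 := fun z => by field_simp
    rw [e1, e2, e2]
    nlinarith [sq_nonneg (u - v - l - 1), mul_nonneg (sub_nonneg.2 huv) (sub_nonneg.2 hv)]
  linarith [hV.lower s, hV.upper t]

lemma comp_neg (hV : IsLoweredGaussian σ h V) : IsLoweredGaussian σ h fun x => V (-x) where
  sigma_pos := hV.sigma_pos
  continuous := hV.continuous.comp continuous_neg
  lower x := by simpa using hV.lower (-x)
  upper x := by simpa using hV.upper (-x)

/-- By `growth_right` the tail is dominated by an exponential of rate `1 / σ`, whose integral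
contributes the factor `σ`. -/
lemma lintegral_Ici_le (hV : IsLoweredGaussian σ h V) {l t : ℝ} (ht : -(l * σ) ≤ t) :
    ∫⁻ x in Set.Ici t, ENNReal.ofReal (targetDensity V x) ≤
      ENNReal.ofReal (σ * Real.exp ((l + 1) ^ 2 / 2 + h)) *
        ENNReal.ofReal (targetDensity V t) := by
  have hσ := hV.sigma_pos
  have hneg : -(1 / σ) < 0 := by
    have : 0 < 1 / σ := by positivity
    linarith
  set D := targetDensity V t * Real.exp ((l + 1) ^ 2 / 2 + h + t / σ) with hD
  have hDpos : 0 < D := mul_pos (hV.targetDensity_pos t) (Real.exp_pos _)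
  have hpt : ∀ x ∈ Set.Ioi t, ENNReal.ofReal (targetDensity V x) ≤
      ENNReal.ofReal (D * Real.exp (-(1 / σ) * x)) := by
    intro x hx
    refine ENNReal.ofReal_le_ofReal ?_
    have hg := hV.growth_right ht (le_of_lt hx)
    rw [hD, targetDensity, targetDensity, div_mul_eq_mul_div, div_mul_eq_mul_div,
      ← Real.exp_add, ← Real.exp_add]
    refine div_le_div_of_nonneg_right (Real.exp_le_exp.2 ?_) hV.integral_pos.le
    have : -(1 / σ) * x + t / σ = -((x - t) / σ) := by ring
    linarith
  rw [setLIntegral_congr Ioi_ae_eq_Ici.symm]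
  refine (setLIntegral_mono' measurableSet_Ioi hpt).trans ?_
  rw [← ofReal_integral_eq_lintegral_ofReal
    ((integrableOn_exp_mul_Ioi hneg t).const_mul D)
    (Filter.Eventually.of_forall fun x => by positivity),
    ← ENNReal.ofReal_mul (by positivity), integral_const_mul, integral_exp_mul_Ioi hneg]
  refine le_of_eq (congrArg _ ?_)
  rw [hD, Real.exp_add _ (t / σ), show -(1 / σ) * t = -(t / σ) by ring, Real.exp_neg]
  field_simp

lemma lintegral_Iic_le (hV : IsLoweredGaussian σ h V) {l t : ℝ} (ht : t ≤ l * σ) :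
    ∫⁻ x in Set.Iic t, ENNReal.ofReal (targetDensity V x) ≤
      ENNReal.ofReal (σ * Real.exp ((l + 1) ^ 2 / 2 + h)) *
        ENNReal.ofReal (targetDensity V t) := by
  have h1 := hV.comp_neg.lintegral_Ici_le (l := l) (t := -t) (by linarith)
  simp only [targetDensity_comp_neg, neg_neg] at h1
  refine le_trans (le_of_eq ?_) h1
  have h2 := (Measure.measurePreserving_neg (volume : Measure ℝ)).setLIntegral_comp_preimage_emb
    (Homeomorph.neg ℝ).measurableEmbedding (fun x => ENNReal.ofReal (targetDensity V x))
    (Set.Iic t)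
  rw [← h2, Set.neg_preimage, Set.neg_Iic]

/-- Sampling from a lowered Gaussian with small Fisher information keeps most of the mass in any
bounded set. -/
lemma ofReal_mul_target_le (hV : IsLoweredGaussian σ h V) {μ : Measure ℝ}
    [IsProbabilityMeasure μ] {l ε : ℝ} {B : Set ℝ} (hB : MeasurableSet B)
    (hBl : B ⊆ Set.Icc (-(l * σ)) (l * σ)) (hε : 0 < ε)
    (hFI : fisherInfo μ (target V) ^ (1 / 2 : ℝ) ≤ ENNReal.ofReal ε) :
    ENNReal.ofReal (1 - 2 * (σ * Real.exp ((l + 1) ^ 2 / 2 + h)) * ε) * target V B ≤ μ B := by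
  have := hV.isProbabilityMeasure_target
  have hσ := hV.sigma_pos
  exact ofReal_mul_measure_le_of_fisherInfo_le hV.continuous_targetDensity
    (π := target V) rfl hB (by positivity)
    hε (fun x₀ hx t ht => hV.lintegral_Ici_le ((hBl hx).1.trans ht))
    (fun x₀ hx t ht => hV.lintegral_Iic_le (ht.trans (hBl hx).2)) hFI

end IsLoweredGaussian

/-! ### A Gaussian with one well -/

/-- A smooth bump on the line, equal to `1` on `[-1, 1]` and supported in `[-2, 2]`. -/
def unitBump : ContDiffBump (0 : ℝ) := ⟨1, 2, one_pos, one_lt_two⟩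

lemma unitBump_eq_one {x : ℝ} (hx : |x| ≤ 1) : unitBump x = 1 :=
  unitBump.one_of_mem_closedBall (by simpa [unitBump] using hx)

lemma unitBump_eq_zero {x : ℝ} (hx : 2 ≤ |x|) : unitBump x = 0 :=
  unitBump.zero_of_le_dist (by simpa [unitBump] using hx)

lemma deriv_unitBump_eq_zero {x : ℝ} (hx : 2 ≤ |x|) : deriv unitBump x = 0 := by
  -- Minimality also covers the boundary `|x| = 2`, where the bump need not be locally constant.
  have : IsLocalMin unitBump x := Filter.Eventually.of_forall fun y => by
    rw [unitBump_eq_zero hx]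
    exact unitBump.nonneg
  exact this.deriv_eq_zero

lemma exists_lipschitz_deriv_unitBump :
    ∃ S : ℝ, 0 ≤ S ∧ ∀ x y, |deriv unitBump x - deriv unitBump y| ≤ S * |x - y| := by
  have h1 : ContDiff ℝ 1 (deriv unitBump) := by
    have : ContDiff ℝ (1 + 1) unitBump := unitBump.contDiff
    exact (contDiff_succ_iff_deriv.1 this).2.2
  obtain ⟨C, hC⟩ := h1.lipschitzWith_of_hasCompactSupport unitBump.hasCompactSupport.deriv
    one_ne_zero
  exact ⟨C, C.2, fun x y => by simpa [Real.dist_eq] using hC.dist_le_mul x y⟩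

/-- The potential of a centred Gaussian with variance `σ²`, with a well of depth `h` and width `w`
at `c`. -/
noncomputable def wellPotential (σ h w c x : ℝ) : ℝ := x ^ 2 / (2 * σ ^ 2) - h * unitBump ((x - c) / w)

lemma wellPotential_zero (σ w c x : ℝ) : wellPotential σ 0 w c x = x ^ 2 / (2 * σ ^ 2) := by
  simp [wellPotential]

lemma contDiff_wellPotential (σ h w c : ℝ) : ContDiff ℝ 2 (wellPotential σ h w c) := by
  unfold wellPotential
  have : ContDiff ℝ 2 unitBump := unitBump.contDiff
  fun_prop

lemma hasDerivAt_wellPotential (σ h w c x : ℝ) :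
    HasDerivAt (wellPotential σ h w c) (x / σ ^ 2 - h * (deriv unitBump ((x - c) / w) / w)) x := by
  have hb : HasDerivAt unitBump (deriv unitBump ((x - c) / w)) ((x - c) / w) :=
    ((unitBump.contDiff (n := 1)).differentiable one_ne_zero _).hasDerivAt
  have h1 : HasDerivAt (fun y : ℝ => (y - c) / w) (1 / w) x :=
    ((hasDerivAt_id x).sub_const c).div_const w
  have h2 := ((hb.comp x h1).const_mul h)
  have h3 : HasDerivAt (fun y : ℝ => y ^ 2 / (2 * σ ^ 2)) (x / σ ^ 2) x := by
    have := (hasDerivAt_pow 2 x).div_const (2 * σ ^ 2)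
    refine this.congr_deriv ?_
    push_cast
    rw [pow_one, mul_div_mul_left _ _ two_ne_zero]
  have h4 := h3.sub h2
  refine h4.congr_deriv ?_
  ring

lemma isLoweredGaussian_wellPotential {σ h : ℝ} (hσ : 0 < σ) (hh : 0 ≤ h) (w c : ℝ) :
    IsLoweredGaussian σ h (wellPotential σ h w c) where
  sigma_pos := hσ
  continuous := (contDiff_wellPotential σ h w c).continuous
  lower x := by
    have : h * unitBump ((x - c) / w) ≤ h * 1 := by
      gcongr
      exact unitBump.le_one
    unfold wellPotential
    linarith
  upper x := by
    have : 0 ≤ h * unitBump ((x - c) / w) := mul_nonneg hh unitBump.nonneg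
    unfold wellPotential
    linarith

lemma wellPotential_eq_of_le_abs (σ h c : ℝ) {w x : ℝ} (hw : 0 < w) (hx : 2 * w ≤ |x - c|) :
    wellPotential σ h w c x = wellPotential σ 0 w c x ∧
      deriv (wellPotential σ h w c) x = deriv (wellPotential σ 0 w c) x := by
  have h2 : 2 ≤ |(x - c) / w| := by
    rw [abs_div, abs_of_pos hw, le_div_iff₀ hw]
    exact hx
  rw [(hasDerivAt_wellPotential σ h w c x).deriv, (hasDerivAt_wellPotential σ 0 w c x).deriv,
    wellPotential, wellPotential, unitBump_eq_zero h2, deriv_unitBump_eq_zero h2]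
  simp

/-- The Lipschitz budget `1` is split evenly: the Gaussian takes `1 / σ ^ 2 ≤ 1 / 2` and the well `S
* h / w ^ 2 ≤ 1 / 2`. -/
lemma isLogSmoothPotential_wellPotential {S σ h w : ℝ}
    (hS : ∀ x y, |deriv unitBump x - deriv unitBump y| ≤ S * |x - y|)
    (hσ : 0 < σ) (hσ2 : 2 ≤ σ ^ 2) (hh : 0 ≤ h) (hw : 0 < w) (hSw : 2 * S * h ≤ w ^ 2) (c : ℝ) :
    IsLogSmoothPotential 1 (wellPotential σ h w c) where
  contDiff := contDiff_wellPotential σ h w c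
  integrable_exp_neg := (isLoweredGaussian_wellPotential hσ hh w c).integrable
  lipschitz_grad x y := by
    rw [(hasDerivAt_wellPotential σ h w c x).deriv, (hasDerivAt_wellPotential σ h w c y).deriv]
    have e : x / σ ^ 2 - h * (deriv unitBump ((x - c) / w) / w) -
        (y / σ ^ 2 - h * (deriv unitBump ((y - c) / w) / w)) =
        (x - y) / σ ^ 2 - (h / w) *
          (deriv unitBump ((x - c) / w) - deriv unitBump ((y - c) / w)) := by ring
    have h1 : |(x - y) / σ ^ 2| ≤ 1 / 2 * |x - y| := by
      rw [abs_div, abs_of_pos (by positivity : 0 < σ ^ 2), div_le_iff₀ (by positivity)]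
      nlinarith [abs_nonneg (x - y)]
    have h2 : |(h / w) * (deriv unitBump ((x - c) / w) - deriv unitBump ((y - c) / w))| ≤
        1 / 2 * |x - y| := by
      rw [abs_mul, abs_of_nonneg (by positivity : 0 ≤ h / w)]
      calc h / w * |deriv unitBump ((x - c) / w) - deriv unitBump ((y - c) / w)|
          ≤ h / w * (S * |(x - c) / w - (y - c) / w|) := by
            gcongr
            exact hS _ _
        _ = (S * h) / w ^ 2 * |x - y| := by
            rw [show (x - c) / w - (y - c) / w = (x - y) / w by ring, abs_div, abs_of_pos hw]
            field_simp
        _ ≤ 1 / 2 * |x - y| := by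
            refine mul_le_mul_of_nonneg_right ?_ (abs_nonneg _)
            rw [div_le_iff₀ (by positivity)]
            linarith
    rw [e]
    exact (abs_sub _ _).trans (by linarith)

lemma integral_exp_neg_wellPotential_le {σ h w c : ℝ} (hσ : 0 < σ) (hh : 0 ≤ h) (hw : 0 < w) :
    ∫ x, Real.exp (-wellPotential σ h w c x) ≤ 3 * σ + 4 * w * Real.exp h := by
  have hG := integrable_exp_neg_sq_div hσ
  have hI : Integrable
      ((Set.Icc (c - 2 * w) (c + 2 * w)).indicator fun _ : ℝ => Real.exp h) := by
    rw [integrable_indicator_iff measurableSet_Icc]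
    exact integrableOn_const (by simp)
  calc ∫ x, Real.exp (-wellPotential σ h w c x)
      ≤ ∫ x, (Real.exp (-(x ^ 2 / (2 * σ ^ 2))) +
          (Set.Icc (c - 2 * w) (c + 2 * w)).indicator (fun _ : ℝ => Real.exp h) x) := by
        refine integral_mono (isLoweredGaussian_wellPotential hσ hh w c).integrable
          (hG.add hI) fun x => ?_
        simp only
        by_cases hx : x ∈ Set.Icc (c - 2 * w) (c + 2 * w)
        · rw [Set.indicator_of_mem hx]
          have h1 := (isLoweredGaussian_wellPotential hσ hh w c).lower x
          have h2 : Real.exp (-wellPotential σ h w c x) ≤ Real.exp h := by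
            refine Real.exp_le_exp.2 ?_
            have : 0 ≤ x ^ 2 / (2 * σ ^ 2) := by positivity
            linarith
          linarith [Real.exp_pos (-(x ^ 2 / (2 * σ ^ 2)))]
        · rw [Set.indicator_of_notMem hx, add_zero]
          have h2 : 2 * w ≤ |x - c| := by
            by_contra hcon
            rw [not_le, abs_lt] at hcon
            exact hx ⟨by linarith, by linarith⟩
          rw [(wellPotential_eq_of_le_abs σ h c hw h2).1, wellPotential_zero]
    _ = (∫ x : ℝ, Real.exp (-(x ^ 2 / (2 * σ ^ 2)))) + 4 * w * Real.exp h := by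
        rw [integral_add hG hI, integral_indicator measurableSet_Icc, setIntegral_const,
          measureReal_def, Real.volume_Icc, ENNReal.toReal_ofReal (by linarith)]
        simp only [smul_eq_mul]
        ring
    _ ≤ _ := by
        gcongr
        exact integral_exp_neg_sq_div_le hσ

/-- A lower bound for the mass of the well. -/
lemma le_target_wellPotential {σ h w c : ℝ} (hσ : 0 < σ) (hh : 0 ≤ h) (hw : 0 < w)
    (hc : Set.Icc (c - w) (c + w) ⊆ Set.Icc (-σ) σ) :
    ENNReal.ofReal (2 * w * (Real.exp (h - 1 / 2) / (3 * σ + 4 * w * Real.exp h))) ≤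
      target (wellPotential σ h w c) (Set.Icc (c - w) (c + w)) := by
  rw [target, withDensity_apply _ measurableSet_Icc]
  have hpt : ∀ x ∈ Set.Icc (c - w) (c + w),
      ENNReal.ofReal (Real.exp (h - 1 / 2) / (3 * σ + 4 * w * Real.exp h)) ≤
        ENNReal.ofReal (targetDensity (wellPotential σ h w c) x) := by
    intro x hx
    refine ENNReal.ofReal_le_ofReal ?_
    refine div_le_div₀ (Real.exp_pos _).le (Real.exp_le_exp.2 ?_)
      (isLoweredGaussian_wellPotential hσ hh w c).integral_pos
      (integral_exp_neg_wellPotential_le hσ hh hw)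
    have h1 : |(x - c) / w| ≤ 1 := by
      rw [abs_div, abs_of_pos hw, div_le_one hw, abs_le]
      constructor <;> linarith [hx.1, hx.2]
    have h2 : x ^ 2 / (2 * σ ^ 2) ≤ 1 / 2 := by
      rw [div_le_div_iff₀ (by positivity) two_pos]
      nlinarith [(hc hx).1, (hc hx).2]
    rw [wellPotential, unitBump_eq_one h1]
    linarith
  refine le_trans (le_of_eq ?_) (setLIntegral_mono' measurableSet_Icc hpt)
  rw [setLIntegral_const, Real.volume_Icc, mul_comm (2 * w), ENNReal.ofReal_mul (by positivity)]
  congr 2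
  ring

/-! ### Hiding a well among exponentially many places -/

/-- All wells share the flat Gaussian as initialization, so counting queries applies; the Fisher
information bound then replaces the output laws by the targets. -/
lemma SamplingAlgorithm.Solves.sum_target_wellPotential_le {A : SamplingAlgorithm} {M ε : ℝ}
    {N : ℕ} (hA : A.Solves M ε N) {S σ w l : ℝ}
    (hS : ∀ x y, |deriv unitBump x - deriv unitBump y| ≤ S * |x - y|)
    (hσ : 0 < σ) (hσ2 : 2 ≤ σ ^ 2) (hM : 0 ≤ M) (hw : 0 < w) (hSw : 2 * S * M ≤ w ^ 2)
    (hε : 0 < ε) {ι : Type*} [Fintype ι] {c : ι → ℝ} {B : ι → Set ℝ}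
    (hc : Pairwise fun i j => 4 * w ≤ |c i - c j|)
    (hB : Pairwise (Function.onFun Disjoint B)) (hBm : ∀ i, MeasurableSet (B i))
    (hBl : ∀ i, B i ⊆ Set.Icc (-(l * σ)) (l * σ)) :
    ∑ i, ENNReal.ofReal (1 - 2 * (σ * Real.exp ((l + 1) ^ 2 / 2 + M)) * ε) *
      target (wellPotential σ M w (c i)) (B i) ≤ N + 1 := by
  have hwell := fun i => isLoweredGaussian_wellPotential hσ hM w (c i)
  have hflat := isLoweredGaussian_wellPotential hσ le_rfl w 0
  have hflatc : ∀ c', wellPotential σ 0 w c' = wellPotential σ 0 w 0 := fun c' =>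
    funext fun x => by rw [wellPotential_zero, wellPotential_zero]
  have hprob := hflat.isProbabilityMeasure_target
  -- The flat Gaussian must itself be an admissible target, so that the reference run also stops
  -- within `N` queries.
  have hflatM : IsLoweredGaussian σ M (wellPotential σ 0 w 0) :=
    { hflat with
      lower := fun x => by linarith [hflat.lower x] }
  obtain ⟨ν₀, hν₀, -⟩ := hA _
    (isLogSmoothPotential_wellPotential hS hσ hσ2 le_rfl hw (by nlinarith) 0) _
    (hflatM.isWarmStart hflat)
  choose ν hν hFI using fun i => hA _
    (isLogSmoothPotential_wellPotential hS hσ hσ2 hM hw hSw (c i)) _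
    ((hwell i).isWarmStart hflat)
  have hdisj : Pairwise (Function.onFun Disjoint fun i => {x : ℝ | |x - c i| < 2 * w}) := by
    intro i j hij
    refine Set.disjoint_left.2 fun x hxi hxj => ?_
    have h1 := hc hij
    have h2 : |c i - c j| ≤ |x - c i| + |x - c j| := by
      rw [abs_sub_comm x (c i)]
      exact abs_sub_le _ _ _
    have h3 : |x - c i| < 2 * w := hxi
    have h4 : |x - c j| < 2 * w := hxj
    linarith
  refine le_trans (Finset.sum_le_sum fun i _ => ?_)
    (SamplingAlgorithm.OutputsWithin.sum_measure_le hdisj hB hBm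
      (fun i x hx => ?_) hν₀ hν)
  · have := (hν i).isProbabilityMeasure
    exact (hwell i).ofReal_mul_target_le (hBm i) (hBl i) hε (hFI i)
  · have hx' : 2 * w ≤ |x - c i| := not_lt.1 hx
    rw [← hflatc (c i)]
    exact wellPotential_eq_of_le_abs σ M (c i) hw hx'

/-- If `n ≤ exp M` wells fit into the bulk, then a well of depth `M` is not found with much fewer
than `n` queries. -/
lemma SamplingAlgorithm.Solves.card_wells_le {A : SamplingAlgorithm} {M ε : ℝ} {N n : ℕ}
    (hA : A.Solves M ε N) {S r : ℝ}
    (hS : ∀ x y, |deriv unitBump x - deriv unitBump y| ≤ S * |x - y|)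
    (hr : 1 ≤ r) (hSr : 2 * S ≤ r ^ 2) (hM : 1 ≤ M) (hn : 1 ≤ n) (hnM : (n : ℝ) ≤ Real.exp M)
    (hε : 0 < ε) (hKε : 4 * (4 * (r * M) * n * Real.exp (2 + M)) * ε ≤ 1) :
    (n : ℝ) / 32 ≤ N + 1 := by
  set w := r * M with hw_def
  have hw1 : 1 ≤ w := one_le_mul_of_one_le_of_one_le hr hM
  have hw : 0 < w := by linarith
  have hn' : (1 : ℝ) ≤ n := by exact_mod_cast hn
  -- Centres `4 * w * i` with `i < n` keep the wells disjoint and inside `[-σ, σ]`.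
  set σ := 4 * w * n with hσ_def
  have hσ4 : 4 ≤ σ := by nlinarith
  have hσ : 0 < σ := by linarith
  have hSw : 2 * S * M ≤ w ^ 2 := by
    rw [hw_def, mul_pow]
    exact mul_le_mul hSr (le_self_pow₀ hM two_ne_zero) (by linarith) (sq_nonneg r)
  have hB : ∀ i : Fin n,
      Set.Icc (4 * w * (i : ℝ) - w) (4 * w * (i : ℝ) + w) ⊆ Set.Icc (-σ) σ := by
    intro i
    have h1 : ((i : ℕ) : ℝ) + 1 ≤ n := by exact_mod_cast i.2
    have h0 : (0 : ℝ) ≤ ((i : ℕ) : ℝ) := Nat.cast_nonneg _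
    refine Set.Icc_subset_Icc ?_ ?_ <;> nlinarith
  have hc : Pairwise fun i j : Fin n => 4 * w ≤ |4 * w * (i : ℝ) - 4 * w * (j : ℝ)| := by
    intro i j hij
    rw [← mul_sub, abs_mul, abs_of_pos (by positivity : 0 < 4 * w)]
    have h1 : (1 : ℤ) ≤ |((i : ℕ) : ℤ) - ((j : ℕ) : ℤ)| := by
      refine Int.one_le_abs (sub_ne_zero.2 ?_)
      exact_mod_cast Fin.val_injective.ne hij
    have h2 : (1 : ℝ) ≤ |((i : ℕ) : ℝ) - ((j : ℕ) : ℝ)| := by exact_mod_cast h1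
    exact le_mul_of_one_le_right (by positivity) h2
  have hdisj : Pairwise (Function.onFun Disjoint fun i : Fin n =>
      Set.Icc (4 * w * (i : ℝ) - w) (4 * w * (i : ℝ) + w)) := by
    intro i j hij
    refine Set.disjoint_left.2 fun x hxi hxj => ?_
    have h1 := hc hij
    have h2 : |4 * w * (i : ℝ) - 4 * w * (j : ℝ)| ≤ 2 * w := by
      rw [abs_le]
      constructor <;> linarith [hxi.1, hxi.2, hxj.1, hxj.2]
    linarith
  have hsum := hA.sum_target_wellPotential_le (l := 1) hS hσ (by nlinarith) (by linarith) hw hSw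
    hε hc hdisj (fun i => measurableSet_Icc) (fun i => by simpa using hB i)
  have hterm : ∀ i : Fin n, ENNReal.ofReal (1 / 32) ≤
      ENNReal.ofReal (1 - 2 * (σ * Real.exp (((1 : ℝ) + 1) ^ 2 / 2 + M)) * ε) *
        target (wellPotential σ M w (4 * w * (i : ℝ)))
          (Set.Icc (4 * w * (i : ℝ) - w) (4 * w * (i : ℝ) + w)) := by
    intro i
    have h1 : (1 : ℝ) / 2 ≤ 1 - 2 * (σ * Real.exp (((1 : ℝ) + 1) ^ 2 / 2 + M)) * ε := by
      rw [show ((1 : ℝ) + 1) ^ 2 / 2 = 2 by norm_num]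
      linarith
    -- Since `n ≤ exp M`, the normalizing constant is at most `12 * w * n + 4 * w * exp M ≤ 16 * w *
    -- exp M`, while the well contributes at least `2 * w * exp (M - 1 / 2) ≥ w * exp M`.
    have h2 : (1 : ℝ) / 16 ≤
        2 * w * (Real.exp (M - 1 / 2) / (3 * σ + 4 * w * Real.exp M)) := by
      have hexp : (1 : ℝ) / 2 ≤ Real.exp (-(1 / 2)) := by
        linarith [Real.add_one_le_exp (-(1 / 2) : ℝ)]
      have hE := Real.exp_pos M
      rw [sub_eq_add_neg, Real.exp_add, ← mul_div_assoc, div_le_div_iff₀ (by norm_num)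
        (by positivity), hσ_def]
      have h3 : w * (n : ℝ) ≤ w * Real.exp M := by gcongr
      have h4 : w * Real.exp M * (1 / 2) ≤ w * Real.exp M * Real.exp (-(1 / 2)) := by gcongr
      linarith
    calc ENNReal.ofReal (1 / 32) = ENNReal.ofReal (1 / 2) * ENNReal.ofReal (1 / 16) := by
          rw [← ENNReal.ofReal_mul (by norm_num)]
          norm_num
      _ ≤ _ := by
          gcongr
          exact (ENNReal.ofReal_le_ofReal h2).trans
            (le_target_wellPotential hσ (by linarith) hw (hB i))
  have hfin := (Finset.sum_le_sum fun i _ => hterm i).trans hsum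
  rw [Finset.sum_const, Finset.card_univ, Fintype.card_fin, nsmul_eq_mul] at hfin
  have h5 : ENNReal.ofReal ((n : ℝ) / 32) ≤ ENNReal.ofReal ((N : ℝ) + 1) := by
    rw [div_eq_mul_one_div, ENNReal.ofReal_mul (by positivity), ENNReal.ofReal_natCast,
      ENNReal.ofReal_add (by positivity) zero_le_one, ENNReal.ofReal_natCast, ENNReal.ofReal_one]
    exact hfin
  exact (ENNReal.ofReal_le_ofReal_iff (by positivity)).1 h5

/-! ### At least one query is needed -/

lemma wellPotential_neg (σ h w c x : ℝ) :
    wellPotential σ h w (-c) x = wellPotential σ h w c (-x) := by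
  rw [wellPotential, wellPotential, neg_sq, ← unitBump.neg, ← neg_div,
    show -(x - -c) = -x - c by ring]

lemma target_comp_neg (V : ℝ → ℝ) {B : Set ℝ} (hB : MeasurableSet B) :
    target (fun x => V (-x)) (-B) = target V B := by
  rw [target, target, withDensity_apply _ hB.neg, withDensity_apply _ hB]
  simp only [targetDensity_comp_neg]
  have h2 := (Measure.measurePreserving_neg (volume : Measure ℝ)).setLIntegral_comp_preimage_emb
    (Homeomorph.neg ℝ).measurableEmbedding (fun x => ENNReal.ofReal (targetDensity V x)) B
  rw [← h2, Set.neg_preimage]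

/-- A well on the right makes the right half-line more likely than the left one. -/
lemma exists_half_lt_target_Ioc {σ h w : ℝ} (hσ : 0 < σ) (hh : 0 < h) (hw : 0 < w) :
    ∃ L : ℝ, 0 < L ∧ 1 / 2 < target (wellPotential σ h w (2 * w)) (Set.Ioc 0 L) := by
  set V := wellPotential σ h w (2 * w) with hVdef
  have hV : IsLoweredGaussian σ h V := isLoweredGaussian_wellPotential hσ hh.le w (2 * w)
  have hprob := hV.isProbabilityMeasure_target
  have hVneg : ∀ x, 0 < x → V (-x) = x ^ 2 / (2 * σ ^ 2) := by
    intro x hx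
    have : 2 * w ≤ |-x - 2 * w| := by
      rw [abs_of_neg (by linarith)]
      linarith
    rw [hVdef, (wellPotential_eq_of_le_abs σ h (2 * w) hw this).1, wellPotential_zero, neg_sq]
  have hlt : target V (Set.Iio 0) < target V (Set.Ioi 0) := by
    have h1 : target V (Set.Iio 0) = target (fun x => V (-x)) (Set.Ioi 0) := by
      rw [← target_comp_neg V measurableSet_Iio]
      simp
    have hfin : target (fun x => V (-x)) (Set.Ioi 0) ≠ ⊤ := by
      rw [← h1]
      exact measure_ne_top _ _
    rw [h1]
    rw [target, withDensity_apply _ measurableSet_Ioi] at hfin ⊢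
    rw [target, withDensity_apply _ measurableSet_Ioi]
    refine lintegral_strict_mono_of_ae_le_of_ae_lt_on
      (hV.continuous_targetDensity.measurable.ennreal_ofReal.aemeasurable) hfin
      ?_ (s := Set.Ioc w (2 * w)) ?_ ?_
    · refine (ae_restrict_iff' measurableSet_Ioi).2 (Filter.Eventually.of_forall fun x hx => ?_)
      refine ENNReal.ofReal_le_ofReal ?_
      rw [targetDensity_comp_neg]
      refine div_le_div_of_nonneg_right (Real.exp_le_exp.2 ?_) hV.integral_pos.le
      rw [hVneg x hx]
      linarith [hV.upper x]
    · rw [Measure.restrict_apply measurableSet_Ioc, Set.inter_eq_left.2, Real.volume_Ioc]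
      · simp [hw, two_mul]
      · exact fun x hx => hw.trans hx.1
    · refine Filter.Eventually.of_forall fun x hx => ?_
      rw [ENNReal.ofReal_lt_ofReal_iff (hV.targetDensity_pos x), targetDensity_comp_neg]
      refine div_lt_div_of_pos_right (Real.exp_lt_exp.2 ?_) hV.integral_pos
      have hb : |(x - 2 * w) / w| ≤ 1 := by
        rw [abs_div, abs_of_pos hw, div_le_one hw, abs_le]
        constructor <;> linarith [hx.1, hx.2]
      rw [hVneg x (hw.trans hx.1), hVdef, wellPotential, unitBump_eq_one hb]
      linarith
  have htot : target V (Set.Iio 0) + target V (Set.Ioi 0) = 1 := by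
    have hac : target V ≪ volume := withDensity_absolutelyContinuous _ _
    have h0 : target V (Set.Iic 0) = target V (Set.Iio 0) :=
      measure_congr (hac.ae_eq Iio_ae_eq_Iic).symm
    rw [← h0, ← Set.compl_Iic]
    exact prob_add_prob_compl measurableSet_Iic
  have hhalf : 1 / 2 < target V (Set.Ioi 0) := by
    by_contra hcon
    rw [not_lt] at hcon
    have h2 := ENNReal.add_lt_add_of_lt_of_le (measure_ne_top _ _) (hlt.trans_le hcon) hcon
    rw [htot, ENNReal.add_halves] at h2
    exact lt_irrefl _ h2
  -- The half-line is exhausted by bounded intervals because the Fisher information estimate needs a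
  -- bounded set.
  have hU : Set.Ioi (0 : ℝ) = ⋃ n : ℕ, Set.Ioc (0 : ℝ) ((n : ℝ) + 1) := by
    ext x
    simp only [Set.mem_Ioi, Set.mem_iUnion, Set.mem_Ioc, exists_and_left]
    refine ⟨fun hx => ⟨hx, ?_⟩, fun hx => hx.1⟩
    obtain ⟨n, hn⟩ := exists_nat_ge x
    exact ⟨n, by linarith⟩
  have hmono : Monotone fun n : ℕ => Set.Ioc (0 : ℝ) ((n : ℝ) + 1) := fun a b hab =>
    Set.Ioc_subset_Ioc_right (by simpa using hab)
  have htend := tendsto_measure_iUnion_atTop (μ := target V) hmono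
  rw [← hU] at htend
  obtain ⟨n, hn⟩ := (htend.eventually_const_lt hhalf).exists
  exact ⟨n + 1, by positivity, hn⟩

/-- No algorithm samples accurately without queries. -/
lemma exists_forall_not_solves_zero :
    ∃ K : ℝ, 0 < K ∧ ∀ (A : SamplingAlgorithm) (ε : ℝ), 0 < ε → K * ε ≤ 1 → ¬ A.Solves 1 ε 0 := by
  obtain ⟨S, hS0, hS⟩ := exists_lipschitz_deriv_unitBump
  set w : ℝ := 1 + 2 * S with hw_def
  have hw : 0 < w := by positivity
  obtain ⟨L, hL, hmass⟩ := exists_half_lt_target_Ioc (σ := 2) (h := 1) two_pos one_pos hw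
  set V := wellPotential 2 1 w (2 * w)
  have hV : IsLoweredGaussian 2 1 V := isLoweredGaussian_wellPotential two_pos zero_le_one w _
  have hprob := hV.isProbabilityMeasure_target
  set m := (target V (Set.Ioc 0 L)).toReal with hm
  have hmeq : target V (Set.Ioc 0 L) = ENNReal.ofReal m :=
    (ENNReal.ofReal_toReal (measure_ne_top _ _)).symm
  have hm1 : m ≤ 1 := by
    have h := prob_le_one (μ := target V) (s := Set.Ioc 0 L)
    rwa [hmeq, ENNReal.ofReal_le_one] at h
  have hm2 : 1 / 2 < m := by
    rw [hm, ← ENNReal.ofReal_lt_iff_lt_toReal (by norm_num) (measure_ne_top _ _),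
      ENNReal.ofReal_div_of_pos two_pos]
    simpa using hmass
  set K := 2 * Real.exp ((L + 1) ^ 2 / 2 + 1) with hK
  have hKpos : 0 < K := by positivity
  -- A well on the right and its mirror image would each need output mass at least `(1 - 2 * K * ε)
  -- * m` on disjoint sets. With `2 * K * ε ≤ (m - 1 / 2) / 2` and `m ≤ 1` the sum is at least `m +
  -- 1 / 2 > 1`, against the bound `N + 1 = 1`.
  refine ⟨2 * K / ((m - 1 / 2) / 2), div_pos (by positivity) (by linarith), fun A ε hε hKε hA => ?_⟩
  have hKε' : 2 * K * ε ≤ (m - 1 / 2) / 2 := by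
    rw [div_mul_eq_mul_div, div_le_one (by linarith)] at hKε
    exact hKε
  let c : Bool → ℝ := fun b => cond b (2 * w) (-(2 * w))
  let B : Bool → Set ℝ := fun b => cond b (Set.Ioc 0 L) (-Set.Ioc 0 L)
  have hc : Pairwise fun i j => 4 * w ≤ |c i - c j| := by
    have e1 : |2 * w - -(2 * w)| = 4 * w := by
      rw [abs_of_pos (by linarith)]
      ring
    have e2 : |-(2 * w) - 2 * w| = 4 * w := by rw [abs_sub_comm, e1]
    intro i j hij
    cases i <;> cases j
    · exact absurd rfl hij
    · exact e2.ge
    · exact e1.ge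
    · exact absurd rfl hij
  have hdisj : Disjoint (Set.Ioc 0 L) (-Set.Ioc 0 L) := by
    refine Set.disjoint_left.2 fun x hx hx' => ?_
    have h1 := (Set.mem_neg.1 hx').1
    linarith [hx.1]
  have hB : Pairwise (Function.onFun Disjoint B) := by
    intro i j hij
    cases i <;> cases j
    · exact absurd rfl hij
    · exact hdisj.symm
    · exact hdisj
    · exact absurd rfl hij
  have hBm : ∀ b, MeasurableSet (B b) := by
    intro b
    cases b
    · exact measurableSet_Ioc.neg
    · exact measurableSet_Ioc
  have hBl : ∀ b, B b ⊆ Set.Icc (-(L * 2)) (L * 2) := by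
    intro b x hx
    cases b
    · have hx' : -x ∈ Set.Ioc 0 L := hx
      constructor <;> linarith [hx'.1, hx'.2]
    · have hx' : x ∈ Set.Ioc 0 L := hx
      constructor <;> linarith [hx'.1, hx'.2]
  have htarget : ∀ b, target (wellPotential 2 1 w (c b)) (B b) = ENNReal.ofReal m := by
    intro b
    rw [← hmeq]
    cases b
    · have e : wellPotential 2 1 w (-(2 * w)) = fun x => V (-x) :=
        funext fun x => wellPotential_neg 2 1 w (2 * w) x
      change target (wellPotential 2 1 w (-(2 * w))) (-Set.Ioc 0 L) = _
      rw [e, target_comp_neg V measurableSet_Ioc]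
    · rfl
  have hsum := hA.sum_target_wellPotential_le hS two_pos (by norm_num) zero_le_one hw
    (by rw [hw_def]; nlinarith) hε hc hB hBm hBl
  simp only [htarget, Fintype.sum_bool, ← hK] at hsum
  rw [← ENNReal.ofReal_mul (by linarith), ← ENNReal.ofReal_add (by nlinarith) (by nlinarith),
    Nat.cast_zero, zero_add, ENNReal.ofReal_le_one] at hsum
  nlinarith

end FisherSampling

/-! ### Choice of the accuracy and conclusion -/

theorem corollaryD3 :
    ∃ c' : ℝ, 0 < c' ∧
      -- the polylogarithmic factor is `C * log (1 / ε) ^ k`, for accuracies `ε < ε₀`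
      ∀ (C : ℝ) (k : ℕ) (ε₀ : ℝ), 0 < C → 0 < ε₀ → ε₀ < 1 →
        ∃ (a : ℝ) (m : ℕ), 0 < a ∧
          ∀ f : ℝ → ℝ, MonotoneOn f (Set.Ici 1) → (∀ M₀ : ℝ, 1 ≤ M₀ → 0 ≤ f M₀) →
            ∀ (A : ℝ → ℝ → FisherSampling.SamplingAlgorithm) (N : ℝ → ℝ → ℕ),
              (∀ M₀ ε : ℝ, 1 ≤ M₀ → 0 < ε → ε < ε₀ →
                (A M₀ ε).Solves M₀ ε (N M₀ ε) ∧
                  (N M₀ ε : ℝ) ≤ f M₀ * (C * Real.log (1 / ε) ^ k)) →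
              ∀ M₀ : ℝ, 1 ≤ M₀ → a * Real.exp (c' * M₀) / M₀ ^ m ≤ f M₀ := by
  obtain ⟨S, hS0, hS⟩ := FisherSampling.exists_lipschitz_deriv_unitBump
  obtain ⟨K, hK, hzero⟩ := FisherSampling.exists_forall_not_solves_zero
  refine ⟨1, one_pos, fun C k ε₀ hC hε₀ hε₀1 => ?_⟩
  set r : ℝ := 1 + 2 * S with hr_def
  have hr : 1 ≤ r := by linarith
  have hSr : 2 * S ≤ r ^ 2 := by rw [hr_def]; nlinarith
  set ε₁ := min (ε₀ / 2) (1 / K) with hε₁_def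
  have hε₁ : 0 < ε₁ := lt_min (by positivity) (by positivity)
  have hε₁lt : ε₁ < ε₀ := (min_le_left _ _).trans_lt (by linarith)
  have hlog₁ : 0 < Real.log (1 / ε₁) :=
    Real.log_pos (by rw [lt_div_iff₀ hε₁]; linarith)
  set q := C * Real.log (1 / ε₁) ^ k with hq_def
  have hq : 0 < q := by positivity
  -- Chosen so that `log (1 / ε) ≤ D * M` below: `log M ≤ M`, `log n ≤ M` and `2 + M ≤ 3 * M` add up
  -- to `5 * M`.
  set D := Real.log (16 * r / ε₀) + 5 with hD_def
  have hlogD : 0 ≤ Real.log (16 * r / ε₀) :=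
    Real.log_nonneg (by rw [le_div_iff₀ hε₀]; linarith)
  have hD : 0 < D := by positivity
  refine ⟨min (1 / (66 * q)) (1 / (64 * (C * D ^ k))), k,
    lt_min (by positivity) (by positivity), fun f hf hf0 A N hAN M hM => ?_⟩
  have hM0 : 0 < M := by linarith
  have hMk : 1 ≤ M ^ k := one_le_pow₀ hM
  have hE := Real.exp_pos M
  rw [one_mul, div_le_iff₀ (by positivity)]
  -- From `66` on, `n / 32 ≤ N + 1` and `n > exp M - 1` give `N ≥ exp M / 64`.
  rcases lt_or_ge (Real.exp M) 66 with hsmall | hlarge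
  · have hf1 : 1 / q ≤ f 1 := by
      obtain ⟨hsol, hN⟩ := hAN 1 ε₁ le_rfl hε₁ hε₁lt
      have hN1 : 1 ≤ N 1 ε₁ := by
        by_contra hcon
        rw [show N 1 ε₁ = 0 by omega] at hsol
        refine hzero _ ε₁ hε₁ ?_ hsol
        rw [mul_comm, ← le_div_iff₀ hK]
        exact min_le_right _ _
      have hN1' : (1 : ℝ) ≤ N 1 ε₁ := by exact_mod_cast hN1
      rw [div_le_iff₀ hq]
      exact hN1'.trans hN
    calc min (1 / (66 * q)) (1 / (64 * (C * D ^ k))) * Real.exp M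
        ≤ 1 / (66 * q) * 66 := by
          gcongr
          exact min_le_left _ _
      _ = 1 / q := by field_simp
      _ ≤ f M := hf1.trans (hf Set.self_mem_Ici hM hM)
      _ ≤ f M * M ^ k := le_mul_of_one_le_right (hf0 M hM) hMk
  · set n := ⌊Real.exp M⌋₊ with hn_def
    have hn : 1 ≤ n := Nat.le_floor (by norm_num; linarith)
    have hn' : (1 : ℝ) ≤ n := by exact_mod_cast hn
    have hnM : (n : ℝ) ≤ Real.exp M := Nat.floor_le hE.le
    have hnM' : Real.exp M < n + 1 := Nat.lt_floor_add_one _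
    set T := 4 * (r * M) * n * Real.exp (2 + M) with hT_def
    have hexp1 : 1 ≤ Real.exp (2 + M) := Real.one_le_exp (by linarith)
    have hT : 1 ≤ T := by
      have h1 : 1 ≤ r * M := one_le_mul_of_one_le_of_one_le hr hM
      exact one_le_mul_of_one_le_of_one_le
        (one_le_mul_of_one_le_of_one_le (by linarith) hn') hexp1
    -- The largest accuracy of this form allowed by `card_wells_le` for every `ε₀ < 1`: it needs `4
    -- * T * ε ≤ 1`, and here `4 * T * ε = ε₀`.
    set ε := ε₀ / (4 * T) with hε_def
    have hε : 0 < ε := by positivity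
    have hεlt : ε < ε₀ := div_lt_self hε₀ (by linarith)
    obtain ⟨hsol, hN⟩ := hAN M ε hM hε hεlt
    have hcard := hsol.card_wells_le hS hr hSr hM hn hnM hε (by
      rw [← hT_def, hε_def, mul_div_cancel₀ _ (by positivity)]
      exact hε₀1.le)
    have hNlow : Real.exp M / 64 ≤ N M ε := by linarith
    have hlog : Real.log (1 / ε) ≤ D * M := by
      have e : 1 / ε = 16 * r / ε₀ * M * n * Real.exp (2 + M) := by
        rw [hε_def, hT_def]
        field_simp
        ring
      have hr0 : 0 < r := by linarith
      have hn0 : (0 : ℝ) < n := by linarith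
      rw [e, Real.log_mul (by positivity) (by positivity),
        Real.log_mul (by positivity) (by positivity),
        Real.log_mul (by positivity) (by positivity), Real.log_exp]
      have h1 : Real.log M ≤ M := (Real.log_le_sub_one_of_pos hM0).trans (by linarith)
      have h2 : Real.log n ≤ M := (Real.log_le_iff_le_exp hn0).2 hnM
      nlinarith
    have hlog0 : 0 ≤ Real.log (1 / ε) :=
      Real.log_nonneg (by rw [le_div_iff₀ hε]; linarith)
    have hfin : Real.exp M / 64 ≤ f M * (C * (D * M) ^ k) := by
      refine hNlow.trans (hN.trans ?_)
      have := hf0 M hM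
      gcongr
    calc min (1 / (66 * q)) (1 / (64 * (C * D ^ k))) * Real.exp M
        ≤ 1 / (64 * (C * D ^ k)) * Real.exp M := by
          gcongr
          exact min_le_right _ _
      _ = Real.exp M / 64 / (C * D ^ k) := by field_simp
      _ ≤ f M * M ^ k := by
          rw [div_le_iff₀ (by positivity)]
          refine hfin.trans (le_of_eq ?_)
          rw [mul_pow]
          ring
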